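/- Fix $d\ge 2$ and let $U_t=\sum_{n=0}^{d-1}e^{-int}|n\rangle\langle n|$, $t\in[0,2\pi)$, be the phase gates on $\mathcal H=\mathbb C^d$. A (probabilistic) gate replication process is a function $M:\mathbb N\to\mathbb N$ together with a sequence of quantum networks. The $N$-th network consists of fixed quantum operations (completely positive, trace non-increasing linear maps), applied successively to $\mathcal H$ and quantum memories of arbitrary finite dimension, with $N$ open slots in which an unknown gate on $\mathcal H$ is inserted. When the gate $U$ is inserted in all $N$ slots, the network implements (upon success) a quantum operation $\mathcal C^{(N)}_U$ from $\mathcal H^{\otimes M(N)}$ to $\mathcal H^{\otimes M(N)}$. The process is deterministic if all the operations in its networks are trace preserving. Its replication rate is $$\alpha=\liminf_{N\to\infty}\frac{\log[M(N)-N]}{\log N}\in[-\infty,\infty],\qquad \log x:=-\infty \text{ for } x\le 0 .$$ With $d\Psi$ the normalized unitarily invariant measure on the unit vectors of $\mathcal H^{\otimes M(N)}$, put $$A_N=\int_0^{2\pi}\!\frac{dt}{2\pi}\int\! d\Psi\,\langle\Psi|(U_t^\dagger)^{\otimes M(N)}\,\mathcal C^{(N)}_{U_t}(|\Psi\rangle\langle\Psi|)\,U_t^{\otimes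 M(N)}|\Psi\rangle,\qquad p_N=\int_0^{2\pi}\!\frac{dt}{2\pi}\int\! d\Psi\,\operatorname{Tr}\,\mathcal C^{(N)}_{U_t}(|\Psi\rangle\langle\Psi|).$$ So $p_N$ is the average probability of success, and the gate fidelity conditional on success is $F_{\rm gate}[N\to M(N)]=A_N/p_N$; for a deterministic process $p_N=1$ and the gate fidelity is $A_N$. Theorem. If the replication rate satisfies $\alpha>2$, then the gate fidelity vanishes asymptotically: (i) for every probabilistic process with $p_N>0$ for all sufficiently large $N$ (no matter how small $p_N$ is), $\lim_{N\to\infty}A_N/p_N=0$; (ii) in particular, for every deterministic process, $\lim_{N\to\infty}A_N=0$. -/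

import Mathlib

open Filter Topology MeasureTheory
open scoped ComplexOrder Matrix Kronecker CStarAlgebra MatrixOrder Matrix.Norms.L2Operator

/-! ### Quantum operations on matrix algebras -/

/-- A quantum operation from the system with Hilbert space `ℂ^m` to the system with Hilbert space
`ℂ^n`: a completely positive, trace non-increasing linear map between matrix algebras, which are
ordered by positive semidefiniteness. -/
structure QuantumOperation (m n : Type) [Fintype m] [DecidableEq m] [Fintype n]
    [DecidableEq n] where
  /-- the completely positive map -/
  toCP : Matrix m m ℂ →CP Matrix n n ℂ
  trace_nonincreasing : ∀ ρ : Matrix m m ℂ, ρ.PosSemidef → (toCP ρ).trace ≤ ρ.trace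

/-- The linear map underlying a quantum operation. -/
def QuantumOperation.map {m n : Type} [Fintype m] [DecidableEq m] [Fintype n] [DecidableEq n]
    (E : QuantumOperation m n) : Matrix m m ℂ →ₗ[ℂ] Matrix n n ℂ :=
  E.toCP.toLinearMap

/-- A quantum operation is a quantum channel if it is trace preserving. -/
def QuantumOperation.IsChannel {m n : Type} [Fintype m] [DecidableEq m] [Fintype n] [DecidableEq n]
    (E : QuantumOperation m n) : Prop :=
  ∀ ρ : Matrix m m ℂ, (E.map ρ).trace = ρ.trace

/-! ### Phase gates -/

/-- The phase gate `U_t = ∑ₙ e^{-int} |n⟩⟨n|` on `ℂ^d`. -/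
noncomputable def phaseGate (d : ℕ) (t : ℝ) : Matrix (Fin d) (Fin d) ℂ :=
  Matrix.diagonal fun n => Complex.exp (-(Complex.I * (n : ℕ) * t))

/-- The tensor power `U^{⊗M}` acting on `(ℂ^d)^{⊗M}`, whose standard basis is indexed by
`Fin M → Fin d`. -/
def tensorPower {d : ℕ} (M : ℕ) (U : Matrix (Fin d) (Fin d) ℂ) :
    Matrix (Fin M → Fin d) (Fin M → Fin d) ℂ :=
  Matrix.of fun i j => ∏ k, U (i k) (j k)

/-- The action `X ↦ (U ⊗ I) X (U ⊗ I)†` of one use of the gate `U` on the first factor of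
`ℂ^d ⊗ ℂ^a`. -/
def applyGate {d : ℕ} (a : ℕ) (U : Matrix (Fin d) (Fin d) ℂ) :
    Matrix (Fin d × Fin a) (Fin d × Fin a) ℂ →ₗ[ℂ] Matrix (Fin d × Fin a) (Fin d × Fin a) ℂ where
  toFun X := (U ⊗ₖ (1 : Matrix (Fin a) (Fin a) ℂ)) * X * (U ⊗ₖ (1 : Matrix (Fin a) (Fin a) ℂ))ᴴ
  map_add' X Y := by rw [Matrix.mul_add, Matrix.add_mul]
  map_smul' c X := by rw [Matrix.mul_smul, Matrix.smul_mul]; rfl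

/-! ### Quantum networks with open slots for a black-box gate -/

/-- The part of a quantum network with input `ℂ^inp` that precedes its last operation.
`OpenNetwork d inp N a` contains `N` open slots for a gate on `ℂ^d`, and its current output is
`ℂ^d ⊗ ℂ^a`, where `ℂ^a` is a quantum memory of arbitrary finite dimension. The memory can hold
other systems, including those on which the gate is yet to act (so that parallel uses of the gate
are covered), and records of earlier outcomes (so that adaptive protocols are covered). -/
inductive OpenNetwork (d : ℕ) (inp : Type) [Fintype inp] [DecidableEq inp] : ℕ → ℕ → Type
  | start {a : ℕ} (E : QuantumOperation inp (Fin d × Fin a)) : OpenNetwork d inp 0 a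
  | step {N a b : ℕ} (P : OpenNetwork d inp N a)
      (E : QuantumOperation (Fin d × Fin a) (Fin d × Fin b)) : OpenNetwork d inp (N + 1) b

/-- The linear map obtained by inserting the gate `U` into all the slots. -/
def OpenNetwork.insert {d : ℕ} {inp : Type} [Fintype inp] [DecidableEq inp] (U : Matrix (Fin d) (Fin d) ℂ) :
    {N a : ℕ} → OpenNetwork d inp N a →
      (Matrix inp inp ℂ →ₗ[ℂ] Matrix (Fin d × Fin a) (Fin d × Fin a) ℂ)
  | _, _, .start E => E.map
  | _, _, .step P E => E.map ∘ₗ applyGate _ U ∘ₗ P.insert U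

/-- All the operations are channels. -/
def OpenNetwork.IsDeterministic {d : ℕ} {inp : Type} [Fintype inp] [DecidableEq inp] :
    {N a : ℕ} → OpenNetwork d inp N a → Prop
  | _, _, .start E => E.IsChannel
  | _, _, .step P E => P.IsDeterministic ∧ E.IsChannel

/-- A (probabilistic) gate replication network: it uses `N` times a gate on `ℂ^d`, in between
fixed quantum operations, and transforms states of `(ℂ^d)^{⊗M}` into states of `(ℂ^d)^{⊗M}`.
The quantum operations describe the branch in which the replication succeeds. -/
structure GateNetwork (d M N : ℕ) where
  /-- the dimension of the memory before the last operation -/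
  memory : ℕ
  /-- everything before the last operation -/
  body : OpenNetwork d (Fin M → Fin d) N memory
  /-- the last operation -/
  last : QuantumOperation (Fin d × Fin memory) (Fin M → Fin d)

namespace GateNetwork

variable {d M N : ℕ}

/-- The map `C_U` implemented (upon success) by the network when all its slots are filled
with `U`. -/
def insert (C : GateNetwork d M N) (U : Matrix (Fin d) (Fin d) ℂ) :
    Matrix (Fin M → Fin d) (Fin M → Fin d) ℂ →ₗ[ℂ] Matrix (Fin M → Fin d) (Fin M → Fin d) ℂ :=
  C.last.map ∘ₗ C.body.insert U

/-- A network is deterministic if all its operations are quantum channels. -/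
def IsDeterministic (C : GateNetwork d M N) : Prop :=
  C.body.IsDeterministic ∧ C.last.IsChannel

end GateNetwork

/-! ### Fidelity -/

/-- The Hilbert space `(ℂ^d)^{⊗M}`. -/
abbrev TensorSpace (d M : ℕ) : Type := EuclideanSpace ℂ (Fin M → Fin d)

/-- The projector `|Ψ⟩⟨Ψ|`. -/
noncomputable def pureState {d M : ℕ} (Ψ : TensorSpace d M) :
    Matrix (Fin M → Fin d) (Fin M → Fin d) ℂ :=
  Matrix.vecMulVec Ψ.ofLp (star Ψ.ofLp)

/-- The average `∫ dt/2π ∫ dΨ f t Ψ`, where `t` is uniform in `[0, 2π)` and `Ψ` is distributed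
according to the normalized unitarily invariant measure on the unit sphere of `(ℂ^d)^{⊗M}`. -/
noncomputable def phaseStateAverage (d M : ℕ) (f : ℝ → TensorSpace d M → ℝ) : ℝ :=
  (2 * Real.pi)⁻¹ * ∫ t in (0 : ℝ)..(2 * Real.pi),
    ⨍ Ψ : Metric.sphere (0 : TensorSpace d M) 1, f t Ψ ∂(volume.toSphere)

namespace GateNetwork

variable {d M N : ℕ}

/-- The average over `t` and `Ψ` of `⟨Ψ| (U_t†)^{⊗M} C_{U_t}(|Ψ⟩⟨Ψ|) U_t^{⊗M} |Ψ⟩`. For a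
deterministic network this is its gate fidelity. -/
noncomputable def averageOverlap (C : GateNetwork d M N) : ℝ :=
  phaseStateAverage d M fun t Ψ =>
    (star Ψ.ofLp ⬝ᵥ
      ((tensorPower M (phaseGate d t))ᴴ * C.insert (phaseGate d t) (pureState Ψ) *
        tensorPower M (phaseGate d t)) *ᵥ Ψ.ofLp).re

/-- The average probability of success, that is, the average over `t` and `Ψ` of
`Tr C_{U_t}(|Ψ⟩⟨Ψ|)`. -/
noncomputable def successProbability (C : GateNetwork d M N) : ℝ :=
  phaseStateAverage d M fun t Ψ => (C.insert (phaseGate d t) (pureState Ψ)).trace.re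

/-- The gate fidelity conditional on success: the average of the fidelity of the normalized output
state with `U_t^{⊗M} |Ψ⟩`, over the posterior distribution (Bayes' rule) of `t` and `Ψ` given
success. -/
noncomputable def gateFidelity (C : GateNetwork d M N) : ℝ :=
  C.averageOverlap / C.successProbability

end GateNetwork

/-- The replication rate `liminf_N log (M(N) - N) / log N`, with `log x = -∞` for `x ≤ 0`. -/
noncomputable def replicationRate (M : ℕ → ℕ) : EReal :=
  liminf (fun N : ℕ =>
    if N < M N then ((Real.log ((M N : ℝ) - (N : ℝ)) / Real.log (N : ℝ) : ℝ) : EReal) else ⊥) atTop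

/-! Only degree counting is used about the network. Each slot multiplies the Kraus operators by a
diagonal matrix of powers `z ^ n`, `n ≤ d - 1`, with `z = e^{-it}`, so the Kraus operators `K_c` of
the whole network are polynomials in `z` of degree at most `(d - 1) * N`, whatever the memory.

Put `D = d ^ M`. The second and fourth moments of the uniform distribution on the sphere turn the
averages over `Ψ` into `p = S / D` and `A = (T + S) / (D * (D + 1))`. Here `S` is the circle mean of
the squared Hilbert–Schmidt norms of the `K_c`, and `T` that of `|tr (U_t^{⊗M})† K_c|²`, both summed
over `c`.

This trace is the sum over digit strings `i` of `z^{-digitSum i} K_c(i,i)`. A given power of `z`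
receives contributions only from strings whose digit sum lies in a window of `(d - 1) * N + 1`
integers. By Parseval and Cauchy–Schwarz, `T ≤ W * S`, with `W` a bound on the number of such
strings.

Digit sums of uniform strings spread over a scale `√M`: a Gaussian bound on their characteristic
function gives each value at most `D * √(dπ / (4M))` strings. Hence `A ≤ p * (((d - 1) * N + 1) *
√(dπ / (4M)) + 1 / D)`. The bound is proportional to `p`, so a small success probability does not
help, and the factor tends to `0` once `M ≥ N ^ r` with `r > 2`. -/

/-! ### Moments of the uniform distribution on the unit sphere -/

section SphereInvariance

open scoped Pointwise

variable {E : Type*} [NormedAddCommGroup E] [InnerProductSpace ℝ E] [FiniteDimensional ℝ E]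
  [MeasurableSpace E] [BorelSpace E]

/-- The restriction of a linear isometry to the unit sphere. -/
def LinearIsometryEquiv.onSphere (V : E ≃ₗᵢ[ℝ] E) (x : Metric.sphere (0 : E) 1) :
    Metric.sphere (0 : E) 1 :=
  ⟨V x, by simp⟩

/-- The surface measure of `s` is a dimensional constant times the volume of the cone `(0,1) • s`;
an isometry carries cones to cones and preserves volume. -/
theorem LinearIsometryEquiv.measurePreserving_onSphere (V : E ≃ₗᵢ[ℝ] E) :
    MeasurePreserving V.onSphere (volume : Measure E).toSphere (volume : Measure E).toSphere := by
  have hm : Measurable V.onSphere :=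
    (V.continuous.measurable.comp measurable_subtype_coe).subtype_mk
  refine ⟨hm, Measure.ext fun s hs => ?_⟩
  rw [Measure.map_apply hm hs, Measure.toSphere_apply' _ hs, Measure.toSphere_apply' _ (hm hs)]
  have h : Set.Ioo (0 : ℝ) 1 • ((↑) '' s : Set E) =
      V '' (Set.Ioo (0 : ℝ) 1 • ((↑) '' (V.onSphere ⁻¹' s) : Set E)) := by
    ext y
    simp only [Set.mem_smul, Set.mem_image, Set.mem_preimage, Subtype.exists, exists_and_right,
      exists_eq_right]
    constructor
    · rintro ⟨r, hr, x, ⟨hx, hxs⟩, rfl⟩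
      refine ⟨r • V.symm x, ⟨r, hr, V.symm x, ⟨by simpa using hx, ?_⟩, rfl⟩, by simp⟩
      simpa [LinearIsometryEquiv.onSphere] using hxs
    · rintro ⟨_, ⟨r, hr, x, ⟨hx, hxs⟩, rfl⟩, rfl⟩
      exact ⟨r, hr, V x, ⟨by simpa using hx, hxs⟩, by simp⟩
  rw [h]
  congr 1
  have := V.symm.measurePreserving.measure_preimage_emb
    V.symm.toHomeomorph.measurableEmbedding
    (Set.Ioo (0 : ℝ) 1 • ((↑) '' (V.onSphere ⁻¹' s) : Set E))
  rw [← this]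
  congr 1
  exact (V.toEquiv.image_eq_preimage_symm _).symm

theorem sphereAverage_comp_linearIsometryEquiv (V : E ≃ₗᵢ[ℝ] E) {f : E → ℂ} (hf : Continuous f) :
    ⨍ x : Metric.sphere (0 : E) 1, f (V x) ∂(volume : Measure E).toSphere =
      ⨍ x : Metric.sphere (0 : E) 1, f x ∂(volume : Measure E).toSphere := by
  rw [average_eq, average_eq]
  congr 1
  have h := V.measurePreserving_onSphere
  have h2 := integral_map (μ := (volume : Measure E).toSphere) h.measurable.aemeasurable
    (f := fun x : Metric.sphere (0 : E) 1 => f x)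
    (by exact (hf.comp continuous_subtype_val).aestronglyMeasurable)
  rw [h.map_eq] at h2
  exact h2.symm

end SphereInvariance

section SphereMoments

variable {ι : Type*} [Fintype ι]

/-- The average of a complex function over the unit sphere of `ℂ^ι`. -/
noncomputable def sphereAverage (f : EuclideanSpace ℂ ι → ℂ) : ℂ :=
  ⨍ x : Metric.sphere (0 : EuclideanSpace ℂ ι) 1, f x
    ∂(volume : Measure (EuclideanSpace ℂ ι)).toSphere

theorem sphereAverage_comp (V : EuclideanSpace ℂ ι ≃ₗᵢ[ℝ] EuclideanSpace ℂ ι)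
    {f : EuclideanSpace ℂ ι → ℂ} (hf : Continuous f) :
    sphereAverage (fun x => f (V x)) = sphereAverage f :=
  sphereAverage_comp_linearIsometryEquiv V hf

theorem integrable_toSphere {G : Type*} [NormedAddCommGroup G] {f : EuclideanSpace ℂ ι → G}
    (hf : Continuous f) (c : ENNReal) (hc : c ≠ ⊤) :
    Integrable (fun x : Metric.sphere (0 : EuclideanSpace ℂ ι) 1 => f x)
      (c • (volume : Measure (EuclideanSpace ℂ ι)).toSphere) := by
  have : IsFiniteMeasure (c • (volume : Measure (EuclideanSpace ℂ ι)).toSphere) :=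
    Measure.smul_finite _ hc
  exact (hf.comp continuous_subtype_val).integrable_of_hasCompactSupport
    (HasCompactSupport.of_compactSpace _)

theorem toSphere_univ_ne_zero [Nonempty ι] :
    (volume : Measure (EuclideanSpace ℂ ι)).toSphere Set.univ ≠ 0 := by
  rw [Ne, Measure.measure_univ_eq_zero]
  exact Measure.toSphere_ne_zero _

theorem integrable_average [Nonempty ι] {G : Type*} [NormedAddCommGroup G]
    {f : EuclideanSpace ℂ ι → G} (hf : Continuous f) :
    Integrable (fun x : Metric.sphere (0 : EuclideanSpace ℂ ι) 1 => f x)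
      (((volume : Measure (EuclideanSpace ℂ ι)).toSphere Set.univ)⁻¹ •
        (volume : Measure (EuclideanSpace ℂ ι)).toSphere) :=
  integrable_toSphere hf _ (ENNReal.inv_ne_top.2 toSphere_univ_ne_zero)

theorem sphereAverage_const_mul (c : ℂ) (f : EuclideanSpace ℂ ι → ℂ) :
    sphereAverage (fun x => c * f x) = c * sphereAverage f := by
  simp only [sphereAverage, average]
  exact integral_const_mul _ _

theorem sphereAverage_sum [Nonempty ι] {α : Type*} (s : Finset α) {f : α → EuclideanSpace ℂ ι → ℂ}
    (hf : ∀ a ∈ s, Continuous (f a)) :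
    sphereAverage (fun x => ∑ a ∈ s, f a x) = ∑ a ∈ s, sphereAverage (f a) := by
  simp only [sphereAverage, average]
  exact integral_finsetSum _ fun a ha => integrable_average (hf a ha)

theorem sphereAverage_eq_of_eq_on_sphere {f g : EuclideanSpace ℂ ι → ℂ}
    (h : ∀ x, ‖x‖ = 1 → f x = g x) : sphereAverage f = sphereAverage g := by
  unfold sphereAverage
  congr 1
  ext x
  exact h _ (by simp)

theorem sphereAverage_const [Nonempty ι] (c : ℂ) :
    sphereAverage (fun _ : EuclideanSpace ℂ ι => c) = c := by
  have : NeZero (volume : Measure (EuclideanSpace ℂ ι)).toSphere :=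
    ⟨Measure.toSphere_ne_zero _⟩
  exact average_const _ _

/-- Invariance under this phase kills moments in which coordinate `p` is not balanced by its
conjugate. -/
theorem exists_isometry_phase [DecidableEq ι] (p : ι) :
    ∃ V : EuclideanSpace ℂ ι ≃ₗᵢ[ℝ] EuclideanSpace ℂ ι,
      ∀ x q, V x q = (if q = p then Complex.I else 1) * x q := by
  refine ⟨LinearIsometryEquiv.piLpCongrRight 2 fun q =>
    rotation (if q = p then ⟨Complex.I, by simp [Submonoid.unitSphere]⟩ else 1), fun x q => ?_⟩
  by_cases h : q = p <;> simp [h, rotation_apply]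

theorem exists_isometry_swap [DecidableEq ι] (p r : ι) :
    ∃ V : EuclideanSpace ℂ ι ≃ₗᵢ[ℝ] EuclideanSpace ℂ ι, ∀ x, V x p = x r := by
  refine ⟨LinearIsometryEquiv.piLpCongrLeft 2 ℝ ℂ (Equiv.swap p r), fun x => ?_⟩
  simp [LinearIsometryEquiv.piLpCongrLeft_apply, Equiv.piCongrLeft']

/-- The reflection in the complex line spanned by `2 e_p - e_r`. -/
theorem exists_isometry_reflection [DecidableEq ι] {p r : ι} (h : p ≠ r) :
    ∃ V : EuclideanSpace ℂ ι ≃ₗᵢ[ℝ] EuclideanSpace ℂ ι,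
      ∀ x, V x p = (3 / 5) * x p - (4 / 5) * x r := by
  -- With `‖u‖² = 5`, the reflection mixes the coordinates with rational coefficients from the 3-4-5
  -- triangle, avoiding square roots.
  let u : EuclideanSpace ℂ ι :=
    (2 : ℂ) • EuclideanSpace.single p (1 : ℂ) - EuclideanSpace.single r (1 : ℂ)
  let R := (Submodule.reflection (Submodule.span ℂ {u}))
  refine ⟨⟨R.toLinearEquiv.restrictScalars ℝ, R.norm_map⟩, fun x => ?_⟩
  have hi (y : EuclideanSpace ℂ ι) : inner ℂ u y = 2 * y p - y r := by
    rw [inner_sub_left, inner_smul_left]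
    simp [EuclideanSpace.inner_single_left, Complex.conj_ofNat]
  have hn : (RCLike.ofReal ‖u‖ : ℂ) ^ 2 = 5 := by
    rw [← inner_self_eq_norm_sq_to_K (𝕜 := ℂ) u, hi]
    simp [u, h, h.symm]
    norm_num
  have := Submodule.reflection_singleton_apply (𝕜 := ℂ) u x
  change R x p = _
  rw [show R x = _ from this, hn, hi]
  simp [u, h]
  ring

end SphereMoments

section FourthMoments

variable {ι : Type*} [Fintype ι]

/-- The fourth moment `E[conj Ψ_i Ψ_j Ψ_k conj Ψ_l]` of the uniform distribution on the sphere. -/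
noncomputable def sphereMoment (i j k l : ι) : ℂ :=
  sphereAverage fun x => star (x i) * x j * x k * star (x l)

theorem sphereMoment_eq_zero [DecidableEq ι] {i j k l : ι}
    (h1 : ¬(i = j ∧ k = l)) (h2 : ¬(i = k ∧ j = l)) : sphereMoment i j k l = 0 := by
  have key (p : ι) : sphereMoment i j k l =
      (star (if i = p then Complex.I else 1) * (if j = p then Complex.I else 1) *
        (if k = p then Complex.I else 1) * star (if l = p then Complex.I else 1)) *
        sphereMoment i j k l := by
    obtain ⟨V, hV⟩ := exists_isometry_phase p
    unfold sphereMoment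
    rw [← sphereAverage_const_mul, ← sphereAverage_comp V (by fun_prop)]
    simp only [hV, star_mul']
    congr 1
    ext x
    ring
  have hI : (Complex.I : ℂ) ≠ 1 := by simp [Complex.ext_iff]
  have of_ne {c z : ℂ} (hc : c ≠ 1) (h : z = c * z) : z = 0 := by
    have : (1 - c) * z = 0 := by linear_combination h
    exact (mul_eq_zero.1 this).resolve_left (sub_ne_zero.2 hc.symm)
  by_cases hji : j = i
  · subst hji
    have hkl : k ≠ l := fun h => h1 ⟨rfl, h⟩
    refine of_ne ?_ (key k)
    by_cases hjk : j = k <;> simp [hjk, hkl.symm, hI]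
  by_cases hjl : j = l
  · subst hjl
    have hki : i ≠ k := fun h => h2 ⟨h, rfl⟩
    refine of_ne ?_ (key k)
    by_cases hjk : j = k <;> simp [hjk, hki, hI]
  -- Here `j` matches neither conjugated index, so the factor is `I`, or `I² = -1` if `k = j`.
  refine of_ne ?_ (key j)
  by_cases hkj : k = j <;> simp [hkj, Ne.symm hji, Ne.symm hjl, hI]
  norm_num

theorem sphereMoment_self [DecidableEq ι] (p r : ι) :
    sphereMoment p p p p = sphereMoment r r r r := by
  obtain ⟨V, hV⟩ := exists_isometry_swap p r
  unfold sphereMoment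
  rw [← sphereAverage_comp V (by fun_prop)]
  simp only [hV]

theorem sphereMoment_comm (i j k l : ι) : sphereMoment i j k l = sphereMoment i k j l := by
  unfold sphereMoment
  congr 1
  ext x
  ring

theorem sphereMoment_comm_star (i j k l : ι) : sphereMoment i j k l = sphereMoment l j k i := by
  unfold sphereMoment
  congr 1
  ext x
  ring

/-- Let `a = E|Ψ_p|⁴` and `b = E|Ψ_p|²|Ψ_r|²`. Expanding `a` after the reflection, the surviving
terms give `625 a = (81 + 256) a + 4 * 144 b`, that is, `a = 2 b`. -/
theorem two_mul_sphereMoment [DecidableEq ι] {p r : ι} (h : p ≠ r) :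
    2 * sphereMoment p p r r = sphereMoment p p p p := by
  obtain ⟨V, hV⟩ := exists_isometry_reflection h
  have : Nonempty ι := ⟨p⟩
  let c : Bool → ℂ := fun b => if b then 3 / 5 else - (4 / 5)
  let e : Bool → ι := fun b => if b then p else r
  have h1 : sphereMoment p p p p = ∑ b : Bool × Bool × Bool × Bool,
      (c b.1 * c b.2.1 * c b.2.2.1 * c b.2.2.2) *
        sphereMoment (e b.1) (e b.2.1) (e b.2.2.1) (e b.2.2.2) := by
    conv_lhs => unfold sphereMoment
    rw [← sphereAverage_comp V (by fun_prop)]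
    simp only [sphereMoment, ← sphereAverage_const_mul]
    rw [← sphereAverage_sum _ (by fun_prop)]
    congr 1
    ext x
    simp only [Fintype.sum_prod_type, Fintype.sum_bool, c, e, hV, star_sub, star_mul']
    simp
    ring
  simp only [Fintype.sum_prod_type, Fintype.sum_bool, c, e] at h1
  have z1 : sphereMoment p p p r = 0 := sphereMoment_eq_zero (by tauto) (by tauto)
  have z2 : sphereMoment p p r p = 0 := sphereMoment_eq_zero (by tauto) (by tauto)
  have z3 : sphereMoment p r p p = 0 := sphereMoment_eq_zero (by tauto) (by tauto)
  have z4 : sphereMoment r p p p = 0 := sphereMoment_eq_zero (by tauto) (by tauto)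
  have z5 : sphereMoment r r r p = 0 := sphereMoment_eq_zero (by tauto) (by tauto)
  have z6 : sphereMoment r r p r = 0 := sphereMoment_eq_zero (by tauto) (by tauto)
  have z7 : sphereMoment r p r r = 0 := sphereMoment_eq_zero (by tauto) (by tauto)
  have z8 : sphereMoment p r r r = 0 := sphereMoment_eq_zero (by tauto) (by tauto)
  have z9 : sphereMoment p r r p = 0 := sphereMoment_eq_zero (by tauto) (by tauto)
  have z10 : sphereMoment r p p r = 0 := sphereMoment_eq_zero (by tauto) (by tauto)
  have e1 : sphereMoment p r p r = sphereMoment p p r r := sphereMoment_comm ..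
  have e2 : sphereMoment r p r p = sphereMoment p p r r := sphereMoment_comm_star ..
  have e3 : sphereMoment r r p p = sphereMoment p p r r := by rw [sphereMoment_comm, e2]
  have e4 := sphereMoment_self p r
  simp [z1, z2, z3, z4, z5, z6, z7, z8, z9, z10, e1, e2, e3, ← e4] at h1
  linear_combination (-625 / 288) * h1

theorem sphereMoment_eq [DecidableEq ι] (i j k l : ι) :
    sphereMoment i j k l =
      ((if i = j ∧ k = l then 1 else 0) + (if i = k ∧ j = l then 1 else 0)) *
        ((Fintype.card ι : ℂ) * (Fintype.card ι + 1))⁻¹ := by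
  have : Nonempty ι := ⟨i⟩
  obtain ⟨b, hb⟩ : ∃ b, ∀ i j k l : ι, sphereMoment i j k l =
      ((if i = j ∧ k = l then 1 else 0) + (if i = k ∧ j = l then 1 else 0)) * b := by
    refine ⟨sphereMoment i i i i / 2, fun i' j k l => ?_⟩
    by_cases h1 : i' = j ∧ k = l
    · obtain ⟨rfl, rfl⟩ := h1
      by_cases h2 : i' = k
      · subst h2
        simp only [and_self, if_true]
        rw [sphereMoment_self i i']
        ring
      · simp only [and_self, if_true, h2, if_false]
        rw [sphereMoment_self i i', ← two_mul_sphereMoment h2]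
        ring
    · by_cases h2 : i' = k ∧ j = l
      · obtain ⟨rfl, rfl⟩ := h2
        have h3 : i' ≠ j := fun h => h1 ⟨h, h⟩
        simp only [and_self, if_true, h3, if_false]
        rw [sphereMoment_comm, sphereMoment_self i i', ← two_mul_sphereMoment h3]
        ring
      · rw [sphereMoment_eq_zero h1 h2]
        simp [h1, h2]
  -- Symmetry leaves one unknown `b`; averaging `‖Ψ‖⁴ = 1` fixes it through `(n² + n) b = 1`.
  have hsum : ∑ i : ι, ∑ k : ι, sphereMoment i i k k = 1 := by
    have h (i : ι) : ∑ k : ι, sphereMoment i i k k =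
        sphereAverage fun x : EuclideanSpace ℂ ι =>
          ∑ k, star (x i) * x i * x k * star (x k) :=
      (sphereAverage_sum _ fun k _ => by fun_prop).symm
    simp_rw [h]
    rw [← sphereAverage_sum _ (fun k _ => by fun_prop), ← sphereAverage_const (ι := ι) 1]
    refine sphereAverage_eq_of_eq_on_sphere fun x hx => ?_
    have h : ∑ k, x k * star (x k) = 1 := by
      have := EuclideanSpace.norm_sq_eq x
      rw [hx] at this
      simp only [RCLike.star_def, Complex.mul_conj, Complex.normSq_eq_norm_sq]
      rw [← Complex.ofReal_sum, ← this]
      simp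
    simp only [mul_assoc, ← Finset.mul_sum, h, mul_one]
    rw [← h]
    exact Finset.sum_congr rfl fun k _ => mul_comm _ _
  rw [hb]
  congr 1
  simp only [hb, and_self, if_true] at hsum
  have h2 : ((Fintype.card ι : ℂ) * (Fintype.card ι + 1)) * b = 1 := by
    refine Eq.trans ?_ hsum
    simp [← Finset.sum_mul, Finset.sum_add_distrib]
    ring
  exact eq_inv_of_mul_eq_one_right h2

/-- The two pairings of indices in the fourth moment produce `|tr X|²` and the squared
Hilbert–Schmidt norm. -/
theorem sphereAverage_normSq_quadratic [Nonempty ι] [DecidableEq ι] (X : Matrix ι ι ℂ) :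
    sphereAverage (fun x => ((Complex.normSq (star x.ofLp ⬝ᵥ X *ᵥ x.ofLp) : ℝ) : ℂ)) =
      ((Complex.normSq X.trace + ∑ i, ∑ j, Complex.normSq (X i j) : ℝ) : ℂ) *
        ((Fintype.card ι : ℂ) * (Fintype.card ι + 1))⁻¹ := by
  have h (x : EuclideanSpace ℂ ι) :
      ((Complex.normSq (star x.ofLp ⬝ᵥ X *ᵥ x.ofLp) : ℝ) : ℂ) =
      ∑ q : ι × ι × ι × ι, (X q.1 q.2.1 * star (X q.2.2.1 q.2.2.2)) *
        (star (x q.1) * x q.2.1 * x q.2.2.1 * star (x q.2.2.2)) := by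
    have hx : star x.ofLp ⬝ᵥ X *ᵥ x.ofLp = ∑ i, ∑ j, star (x i) * X i j * x j := by
      simp [dotProduct, Matrix.mulVec, Finset.mul_sum, mul_assoc]
    rw [← Complex.mul_conj, hx]
    simp only [Fintype.sum_prod_type, map_sum, Finset.sum_mul]
    refine Finset.sum_congr rfl fun i _ => Finset.sum_congr rfl fun j _ => ?_
    rw [Finset.mul_sum]
    refine Finset.sum_congr rfl fun k _ => ?_
    rw [Finset.mul_sum]
    refine Finset.sum_congr rfl fun l _ => ?_
    simp
    ring
  simp_rw [h]
  rw [sphereAverage_sum _ (fun k _ => by fun_prop)]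
  simp_rw [sphereAverage_const_mul]
  have h3 (i j k l : ι) :
      sphereAverage (fun x : EuclideanSpace ℂ ι => star (x i) * x j * x k * star (x l)) = _ :=
    sphereMoment_eq i j k l
  simp_rw [h3, ← mul_assoc]
  rw [← Finset.sum_mul]
  congr 1
  simp only [Fintype.sum_prod_type, mul_add, Finset.sum_add_distrib, Complex.ofReal_add]
  congr 1
  · simp only [ite_and, mul_ite, mul_one, mul_zero]
    simp [Matrix.trace, ← Complex.mul_conj, Finset.sum_mul_sum]
  · simp only [ite_and, mul_ite, mul_one, mul_zero]
    simp [← Complex.mul_conj]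

/-- Inserting `1 = ∑ |x_k|²` reduces the second moment to fourth moments. -/
theorem sphereAverage_mul_star [Nonempty ι] [DecidableEq ι] (i j : ι) :
    sphereAverage (fun x : EuclideanSpace ℂ ι => x i * star (x j)) =
      if i = j then (Fintype.card ι : ℂ)⁻¹ else 0 := by
  have h : sphereAverage (fun x : EuclideanSpace ℂ ι => x i * star (x j)) =
      ∑ k, sphereMoment k k i j := by
    simp only [sphereMoment]
    rw [← sphereAverage_sum _ (fun k _ => by fun_prop)]
    refine sphereAverage_eq_of_eq_on_sphere fun x hx => ?_
    have h : ∑ k, star (x k) * x k = 1 := by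
      have := EuclideanSpace.norm_sq_eq x
      rw [hx] at this
      simp only [RCLike.star_def, Complex.conj_mul', ← Complex.ofReal_pow]
      rw [← Complex.ofReal_sum, ← this]
      simp
    simp only [mul_assoc]
    simp only [← mul_assoc, ← Finset.sum_mul, h, one_mul]
  rw [h]
  simp only [sphereMoment_eq, ← Finset.sum_mul, Finset.sum_add_distrib]
  have hn : (Fintype.card ι : ℂ) ≠ 0 := by simp
  have hn' : (Fintype.card ι : ℂ) + 1 ≠ 0 := by
    exact_mod_cast Nat.succ_ne_zero (Fintype.card ι)
  by_cases hij : i = j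
  · subst hij
    simp
    field_simp
  · have : ∀ k, ¬ (k = i ∧ k = j) := fun k h => hij (h.1.symm.trans h.2)
    simp [hij, this]

end FourthMoments

/-! ### Kraus representations -/

section Kraus

variable {m n : Type} [Fintype m] [DecidableEq m] [Fintype n] [DecidableEq n]

/-- This block matrix is the unnormalized maximally entangled projector, written as `V* V` with a
single nonzero block row in `V`. Its image under a completely positive map is the Choi matrix. -/
theorem cstarMatrix_single_nonneg :
    (0 : CStarMatrix m m (Matrix m m ℂ)) ≤
      CStarMatrix.ofMatrix (Matrix.of fun a b => Matrix.single a b (1 : ℂ)) := by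
  rcases isEmpty_or_nonempty m with h | ⟨⟨i⟩⟩
  · exact le_of_eq (CStarMatrix.ext fun a => h.elim a)
  · have h : CStarMatrix.ofMatrix (Matrix.of fun a b : m => Matrix.single a b (1 : ℂ)) =
        star (CStarMatrix.ofMatrix
          (Matrix.of fun c b : m => if c = i then Matrix.single i b (1 : ℂ) else 0)) *
        CStarMatrix.ofMatrix
          (Matrix.of fun c b : m => if c = i then Matrix.single i b (1 : ℂ) else 0) := by
      refine CStarMatrix.ext fun a b => ?_
      simp [CStarMatrix.mul_apply, CStarMatrix.star_apply, Matrix.star_eq_conjTranspose,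
        CStarMatrix.ofMatrix_apply]
    rw [h]
    exact star_mul_self_nonneg _

theorem exists_eq_star_mul_self_of_nonneg {A : Type*} [NonUnitalCStarAlgebra A] [PartialOrder A]
    [StarOrderedRing A] {a : A} (h : 0 ≤ a) : ∃ b, a = star b * b :=
  CStarAlgebra.nonneg_iff_eq_star_mul_self.1 h

/-- Every quantum operation has a Kraus representation. -/
theorem QuantumOperation.exists_kraus (E : QuantumOperation m n) :
    ∃ K : m × n → Matrix n m ℂ, ∀ X, E.map X = ∑ c, K c * X * (K c)ᴴ := by
  have h := E.toCP.map_cstarMatrix_nonneg _ (cstarMatrix_single_nonneg (m := m))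
  obtain ⟨B, hB⟩ := exists_eq_star_mul_self_of_nonneg h
  have hE (a b : m) : E.map (Matrix.single a b 1) = ∑ c, (B c a)ᴴ * B c b := by
    have := congrArg (fun Y : CStarMatrix m m (Matrix n n ℂ) => Y a b) hB
    simpa [CStarMatrix.mul_apply, CStarMatrix.star_apply, Matrix.star_eq_conjTranspose,
        CStarMatrix.ofMatrix_apply] using! this
  -- The Choi matrix is `B* B`; each of its scalar rows, a block row `c.1` and a row `c.2` inside
  -- the blocks, gives one Kraus operator after conjugation.
  refine ⟨fun c => Matrix.of fun i a => star (B c.1 a c.2 i), fun X => ?_⟩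
  conv_lhs => rw [Matrix.matrix_eq_sum_single X]
  simp only [map_sum]
  have hs (a b : m) : Matrix.single a b (X a b) = X a b • Matrix.single a b (1 : ℂ) := by simp
  simp_rw [hs, map_smul, hE]
  ext i j
  simp only [Matrix.sum_apply, Matrix.smul_apply, Matrix.mul_apply, Matrix.conjTranspose_apply,
    Matrix.of_apply, smul_eq_mul, star_star, Fintype.sum_prod_type, Finset.mul_sum, Finset.sum_mul]
  have (f : m → m → m → n → ℂ) :
      ∑ a, ∑ b, ∑ c, ∑ l, f a b c l = ∑ c, ∑ l, ∑ b, ∑ a, f a b c l :=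
    calc _ = ∑ a, ∑ c, ∑ b, ∑ l, f a b c l := Finset.sum_congr rfl fun a _ => Finset.sum_comm
      _ = ∑ c, ∑ a, ∑ b, ∑ l, f a b c l := Finset.sum_comm
      _ = ∑ c, ∑ b, ∑ a, ∑ l, f a b c l := Finset.sum_congr rfl fun a _ => Finset.sum_comm
      _ = ∑ c, ∑ b, ∑ l, ∑ a, f a b c l :=
        Finset.sum_congr rfl fun a _ => Finset.sum_congr rfl fun b _ => Finset.sum_comm
      _ = _ := Finset.sum_congr rfl fun a _ => Finset.sum_comm
  rw [this]
  refine Finset.sum_congr rfl fun c _ => Finset.sum_congr rfl fun l _ =>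
    Finset.sum_congr rfl fun b _ => Finset.sum_congr rfl fun a _ => ?_
  ring

end Kraus

/-! ### Networks as polynomials in the eigenvalues of the gate -/

section Networks

open Polynomial

variable {d : ℕ}

theorem phaseGate_kronecker_one (a : ℕ) (t : ℝ) :
    phaseGate d t ⊗ₖ (1 : Matrix (Fin a) (Fin a) ℂ) =
      (Matrix.diagonal fun q : Fin d × Fin a => (X : ℂ[X]) ^ (q.1 : ℕ)).map
        (evalRingHom (Complex.exp (-(Complex.I * t)))) := by
  rw [phaseGate, ← Matrix.diagonal_one, Matrix.diagonal_kronecker_diagonal,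
    Matrix.diagonal_map (map_zero _)]
  congr 1
  ext q
  simp [← Complex.exp_nat_mul]
  ring_nf

/-- Fixed operations contribute constant Kraus matrices; each slot contributes `diag (X ^ n)` with
`n ≤ d - 1`, so it raises degrees by at most `d - 1`. -/
theorem OpenNetwork.exists_polynomial_kraus {inp : Type} [Fintype inp] [DecidableEq inp]
    {N a : ℕ} (P : OpenNetwork d inp N a) :
    ∃ (κ : Type) (_ : Fintype κ) (Q : κ → Matrix (Fin d × Fin a) inp ℂ[X]),
      (∀ c i j, (Q c i j).natDegree ≤ (d - 1) * N) ∧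
      ∀ (t : ℝ) (Y : Matrix inp inp ℂ), P.insert (phaseGate d t) Y =
        ∑ c, (Q c).map (evalRingHom (Complex.exp (-(Complex.I * t)))) * Y *
          ((Q c).map (evalRingHom (Complex.exp (-(Complex.I * t)))))ᴴ := by
  induction P with
  | start E =>
    obtain ⟨K, hK⟩ := E.exists_kraus
    refine ⟨_, inferInstance, fun c => (K c).map C, by simp, fun t Y => ?_⟩
    simp only [OpenNetwork.insert, hK]
    refine Finset.sum_congr rfl fun c _ => ?_
    have : ((K c).map C).map (evalRingHom (Complex.exp (-(Complex.I * t)))) = K c := by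
      ext; simp
    rw [this]
  | @step N a b P E ih =>
    obtain ⟨κ, _, Q, hQ, hP⟩ := ih
    obtain ⟨K, hK⟩ := E.exists_kraus
    refine ⟨((Fin d × Fin a) × (Fin d × Fin b)) × κ, inferInstance, fun c => (K c.1).map C *
      ((Matrix.diagonal fun q : Fin d × Fin a => (X : ℂ[X]) ^ (q.1 : ℕ)) * Q c.2),
      fun c i j => ?_, fun t Y => ?_⟩
    · beta_reduce
      rw [Matrix.mul_apply]
      refine natDegree_sum_le_of_forall_le _ _ fun q _ => ?_
      rw [Matrix.diagonal_mul, Matrix.map_apply]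
      refine (natDegree_C_mul_le _ _).trans (natDegree_mul_le.trans ?_)
      rw [natDegree_X_pow, mul_add, mul_one, add_comm]
      exact add_le_add (hQ _ _ _) (by omega)
    · simp only [OpenNetwork.insert, LinearMap.comp_apply, hK, hP, applyGate, LinearMap.coe_mk,
        AddHom.coe_mk, phaseGate_kronecker_one]
      refine (Finset.sum_congr rfl fun c _ => ?_).trans (Fintype.sum_prod_type _).symm
      simp only [Matrix.mul_sum, Matrix.sum_mul]
      refine Finset.sum_congr rfl fun e _ => ?_
      have : ((K c).map C).map (evalRingHom (Complex.exp (-(Complex.I * t)))) = K c := by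
        ext; simp
      simp only [Matrix.map_mul, this, Matrix.conjTranspose_mul, Matrix.mul_assoc]

theorem GateNetwork.exists_polynomial_kraus {M N : ℕ} (G : GateNetwork d M N) :
    ∃ (κ : Type) (_ : Fintype κ) (Q : κ → Matrix (Fin M → Fin d) (Fin M → Fin d) ℂ[X]),
      (∀ c i j, (Q c i j).natDegree ≤ (d - 1) * N) ∧
      ∀ (t : ℝ) (Y : Matrix (Fin M → Fin d) (Fin M → Fin d) ℂ), G.insert (phaseGate d t) Y =
        ∑ c, (Q c).map (evalRingHom (Complex.exp (-(Complex.I * t)))) * Y *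
          ((Q c).map (evalRingHom (Complex.exp (-(Complex.I * t)))))ᴴ := by
  obtain ⟨κ, _, Q, hQ, hP⟩ := G.body.exists_polynomial_kraus
  obtain ⟨K, hK⟩ := G.last.exists_kraus
  refine ⟨((Fin d × Fin G.memory) × (Fin M → Fin d)) × κ, inferInstance,
    fun c => (K c.1).map C * Q c.2, fun c i j => ?_, fun t Y => ?_⟩
  · beta_reduce
    rw [Matrix.mul_apply]
    refine natDegree_sum_le_of_forall_le _ _ fun q _ => ?_
    rw [Matrix.map_apply]
    exact (natDegree_C_mul_le _ _).trans (hQ _ _ _)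
  · simp only [GateNetwork.insert, LinearMap.comp_apply, hK, hP]
    refine (Finset.sum_congr rfl fun c _ => ?_).trans (Fintype.sum_prod_type _).symm
    simp only [Matrix.mul_sum, Matrix.sum_mul]
    refine Finset.sum_congr rfl fun e _ => ?_
    have : ((K c).map C).map (evalRingHom (Complex.exp (-(Complex.I * t)))) = K c := by
      ext; simp
    simp only [Matrix.map_mul, this, Matrix.conjTranspose_mul, Matrix.mul_assoc]

end Networks

/-! ### Anti-concentration of sums of independent uniform digits -/

section AntiConcentration

variable {d : ℕ}

/-- The number of excitations of a string of digits. -/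
def digitSum {M : ℕ} (i : Fin M → Fin d) : ℕ := ∑ k, (i k : ℕ)

/-- The terms `n = 0, 1` add up to modulus `2 cos (t / 2)` and the others have modulus `1`. Then
`cos u ≤ 1 - 2u²/π²` and `1 + x ≤ e^x` give the Gaussian. -/
theorem norm_sum_exp_le (hd : 2 ≤ d) {t : ℝ} (ht : |t| ≤ Real.pi) :
    ‖∑ n : Fin d, Complex.exp (((n : ℕ) * t : ℝ) * Complex.I)‖ ≤
      d * Real.exp (-(1 / (d * Real.pi ^ 2)) * t ^ 2) := by
  have hd0 : (0 : ℝ) < d := by positivity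
  have h1 : ‖1 + Complex.exp (t * Complex.I)‖ ≤ 2 * Real.cos (t / 2) := by
    have hc : 0 ≤ Real.cos (t / 2) := by
      apply Real.cos_nonneg_of_mem_Icc
      constructor <;> linarith [(abs_le.1 ht).1, (abs_le.1 ht).2]
    have h : 1 + Complex.exp (t * Complex.I) =
        Complex.exp (((t / 2 : ℝ) : ℂ) * Complex.I) * (2 * Real.cos (t / 2) : ℝ) := by
      push_cast
      rw [Complex.two_cos, mul_add, ← Complex.exp_add, ← Complex.exp_add, add_comm]
      congr 1
      · congr 1; ring
      · rw [← Complex.exp_zero]; congr 1; ring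
    rw [h, norm_mul, Complex.norm_exp_ofReal_mul_I, one_mul, Complex.norm_real, Real.norm_eq_abs,
      abs_of_nonneg (by positivity)]
  have h2 : ‖∑ n : Fin d, Complex.exp (((n : ℕ) * t : ℝ) * Complex.I)‖ ≤
      2 * Real.cos (t / 2) + (d - 2) := by
    obtain ⟨e, rfl⟩ := Nat.exists_eq_add_of_le hd
    rw [Fin.sum_univ_eq_sum_range
      (fun n => Complex.exp (((n : ℕ) * t : ℝ) * Complex.I)), Finset.sum_range_add]
    refine (norm_add_le _ _).trans (add_le_add ?_ ?_)
    · simpa [Finset.sum_range_succ] using h1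
    · refine (norm_sum_le _ _).trans ?_
      simp only [Complex.norm_exp_ofReal_mul_I]
      simp
  have h3 : Real.cos (t / 2) ≤ 1 - 2 / Real.pi ^ 2 * (t / 2) ^ 2 :=
    Real.cos_le_one_sub_mul_cos_sq (by rw [abs_div, abs_two]; linarith [abs_nonneg t])
  have h4 := Real.add_one_le_exp (-(1 / (d * Real.pi ^ 2)) * t ^ 2)
  refine h2.trans (le_trans ?_ (mul_le_mul_of_nonneg_left h4 hd0.le))
  have : (d : ℝ) * (-(1 / (d * Real.pi ^ 2)) * t ^ 2 + 1) =
      d - 2 * (2 / Real.pi ^ 2 * (t / 2) ^ 2) := by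
    field_simp
    ring
  rw [this]
  linarith

/-- Fourier inversion: the `M`-th power of the one-digit sum generates the digit-sum counts, and
orthogonality of characters extracts one of them. -/
theorem card_digitSum_eq_integral {M : ℕ} (s : ℕ) :
    (((Finset.univ.filter fun i : Fin M → Fin d => digitSum i = s).card : ℕ) : ℂ) * (2 * Real.pi) =
      ∫ t in (-Real.pi)..Real.pi, (∑ n : Fin d, Complex.exp (((n : ℕ) * t : ℝ) * Complex.I)) ^ M *
        Complex.exp ((-(s * t) : ℝ) * Complex.I) := by
  have h (t : ℝ) : (∑ n : Fin d, Complex.exp (((n : ℕ) * t : ℝ) * Complex.I)) ^ M *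
        Complex.exp ((-(s * t) : ℝ) * Complex.I) =
      ∑ i : Fin M → Fin d, Complex.exp ((((digitSum i : ℤ) - s : ℤ) * Complex.I) * t) := by
    have : (∑ n : Fin d, Complex.exp (((n : ℕ) * t : ℝ) * Complex.I)) ^ M =
        ∏ _k : Fin M, ∑ n : Fin d, Complex.exp (((n : ℕ) * t : ℝ) * Complex.I) := by simp
    rw [this, Finset.prod_univ_sum, Finset.sum_mul, Fintype.piFinset_univ]
    refine Finset.sum_congr rfl fun i _ => ?_
    rw [← Complex.exp_sum, ← Complex.exp_add]
    congr 1
    simp only [digitSum]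
    push_cast
    rw [← Finset.sum_mul, ← Finset.sum_mul]
    ring
  simp_rw [h]
  rw [intervalIntegral.integral_finsetSum fun i _ =>
    (by fun_prop : Continuous _).intervalIntegrable _ _]
  have h2 (k : ℤ) : ∫ t in (-Real.pi)..Real.pi, Complex.exp ((k * Complex.I) * t) =
      if k = 0 then 2 * Real.pi else 0 := by
    split_ifs with hk
    · subst hk
      simp
      ring
    · rw [integral_exp_mul_complex (by simpa using hk)]
      have : Complex.exp (k * Complex.I * (Real.pi : ℝ)) =
          Complex.exp (k * Complex.I * ((-Real.pi : ℝ) : ℂ)) := by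
        rw [Complex.exp_eq_exp_iff_exists_int]
        exact ⟨k, by push_cast; ring⟩
      rw [this]
      simp
  simp_rw [h2]
  rw [Finset.card_filter]
  push_cast
  rw [Finset.sum_mul]
  refine Finset.sum_congr rfl fun i _ => ?_
  by_cases hi : digitSum i = s
  · simp [hi]
  · have : ((digitSum i : ℤ) - s) ≠ 0 := by omega
    simp [hi, this]

/-- The Fourier integrand is dominated by `d ^ M * exp (-b t²)`, `b = M / (dπ²)`; extending to the
whole line gives `√(π / b) / (2π) = √(dπ / (4M))`. -/
theorem card_digitSum_le (hd : 2 ≤ d) {M : ℕ} (hM : 0 < M) (s : ℕ) :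
    (((Finset.univ.filter fun i : Fin M → Fin d => digitSum i = s).card : ℕ) : ℝ) ≤
      d ^ M * Real.sqrt (d * Real.pi / 4 / M) := by
  have hd0 : (0 : ℝ) < d := by positivity
  have hM0 : (0 : ℝ) < M := by positivity
  set b : ℝ := M * (1 / (d * Real.pi ^ 2)) with hb
  have hb0 : 0 < b := by positivity
  have h := congrArg norm (card_digitSum_eq_integral (d := d) (M := M) s)
  rw [norm_mul, Complex.norm_natCast] at h
  have h2 : ‖(2 * Real.pi : ℂ)‖ = 2 * Real.pi := by
    simp [Real.pi_pos.le]
  rw [h2] at h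
  have h3 : ‖∫ t in (-Real.pi)..Real.pi,
      (∑ n : Fin d, Complex.exp (((n : ℕ) * t : ℝ) * Complex.I)) ^ M *
        Complex.exp ((-(s * t) : ℝ) * Complex.I)‖ ≤
      ∫ t in (-Real.pi)..Real.pi, d ^ M * Real.exp (-b * t ^ 2) := by
    refine intervalIntegral.norm_integral_le_of_norm_le (by linarith [Real.pi_pos]) ?_
      ((by fun_prop : Continuous _).intervalIntegrable _ _)
    refine Eventually.of_forall fun t ht => ?_
    rw [norm_mul, Complex.norm_exp_ofReal_mul_I, mul_one, norm_pow]
    have := norm_sum_exp_le hd (t := t) (abs_le.2 ⟨ht.1.le, ht.2⟩)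
    refine (pow_le_pow_left₀ (norm_nonneg _) this M).trans (le_of_eq ?_)
    rw [mul_pow, ← Real.exp_nat_mul]
    congr 2
    rw [hb]
    ring
  have h4 : ∫ t in (-Real.pi)..Real.pi, d ^ M * Real.exp (-b * t ^ 2) ≤
      d ^ M * Real.sqrt (Real.pi / b) := by
    rw [intervalIntegral.integral_const_mul, ← integral_gaussian,
      intervalIntegral.integral_of_le (by linarith [Real.pi_pos])]
    refine mul_le_mul_of_nonneg_left ?_ (by positivity)
    exact setIntegral_le_integral (integrable_exp_neg_mul_sq hb0)
      (Eventually.of_forall fun t => (Real.exp_pos _).le)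
  have h5 : Real.sqrt (Real.pi / b) = Real.sqrt (d * Real.pi / 4 / M) * (2 * Real.pi) := by
    rw [← Real.sqrt_sq (by positivity : 0 ≤ 2 * Real.pi), ← Real.sqrt_mul (by positivity)]
    congr 1
    rw [hb]
    field_simp
    ring
  rw [← h] at h3
  have h6 := h3.trans h4
  rw [h5, ← mul_assoc ((d : ℝ) ^ M)] at h6
  exact le_of_mul_le_mul_right (a := 2 * Real.pi) h6 (by positivity)

/-- The number of strings with between `R - n` and `R - n + L` excitations. -/
theorem card_digitSum_window_le (hd : 2 ≤ d) {M : ℕ} (hM : 0 < M) (L R n : ℕ) :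
    (((Finset.univ.filter fun i : Fin M → Fin d =>
      R ≤ n + digitSum i ∧ n + digitSum i ≤ R + L).card : ℕ) : ℝ) ≤
      (L + 1) * (d ^ M * Real.sqrt (d * Real.pi / 4 / M)) := by
  have h : (Finset.univ.filter fun i : Fin M → Fin d =>
      R ≤ n + digitSum i ∧ n + digitSum i ≤ R + L) ⊆
      (Finset.range (L + 1)).biUnion fun k =>
        -- Truncated subtraction is harmless: only an inclusion is needed, and the witness `k` has
        -- `R + k = n + digitSum i`.
        Finset.univ.filter fun i : Fin M → Fin d => digitSum i = R + k - n := by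
    intro i hi
    simp only [Finset.mem_filter, Finset.mem_univ, true_and, Finset.mem_biUnion,
      Finset.mem_range] at hi ⊢
    exact ⟨n + digitSum i - R, by omega, by omega⟩
  have h2 := (Finset.card_le_card h).trans Finset.card_biUnion_le
  refine (Nat.cast_le.2 h2).trans ?_
  push_cast
  refine (Finset.sum_le_sum fun k _ => card_digitSum_le hd hM (R + k - n)).trans ?_
  simp

end AntiConcentration

/-! ### Mean squares of polynomials on the unit circle -/

section MeanSquare

open Polynomial

/-- The mean of `|p|²` over the unit circle. -/
noncomputable def circleMeanSq (p : ℂ[X]) : ℝ :=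
  (2 * Real.pi)⁻¹ * ∫ t in (0 : ℝ)..(2 * Real.pi),
    Complex.normSq (p.eval (Complex.exp (-(Complex.I * t))))

/-- Parseval; the substitution `t ↦ 2π - t` reconciles `e^{-it}` with the standard parametrization
of the circle. -/
theorem circleMeanSq_eq_sum_coeff {p : ℂ[X]} {n : ℕ} (h : p.natDegree < n) :
    circleMeanSq p = ∑ k ∈ Finset.range n, Complex.normSq (p.coeff k) := by
  have h1 : ∑ k ∈ Finset.range n, Complex.normSq (p.coeff k) =
      ∑ k ∈ p.support, ‖p.coeff k‖ ^ 2 := by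
    simp only [← Complex.normSq_eq_norm_sq]
    symm
    refine Finset.sum_subset (fun k hk => ?_) fun k _ hk => ?_
    · exact Finset.mem_range.2 ((le_natDegree_of_mem_supp k hk).trans_lt h)
    · simp [notMem_support_iff.1 hk]
  rw [h1, p.sum_sq_norm_coeff_eq_circleAverage, Real.circleAverage, circleMeanSq, smul_eq_mul]
  congr 1
  have h2 := intervalIntegral.integral_comp_sub_left
    (fun t : ℝ => Complex.normSq (p.eval (Complex.exp (-(Complex.I * t))))) (2 * Real.pi)
    (a := 0) (b := 2 * Real.pi)
  rw [sub_self, sub_zero] at h2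
  rw [← h2]
  refine intervalIntegral.integral_congr fun t _ => ?_
  have h3 : Complex.exp (-(Complex.I * ((2 * Real.pi - t : ℝ) : ℂ))) = circleMap 0 1 t := by
    rw [circleMap, Complex.ofReal_one, one_mul, zero_add, Complex.exp_eq_exp_iff_exists_int]
    exact ⟨-1, by push_cast; ring⟩
  simp only [h3, Complex.normSq_eq_norm_sq]

theorem circleMeanSq_nonneg (p : ℂ[X]) : 0 ≤ circleMeanSq p :=
  mul_nonneg (by positivity)
    (intervalIntegral.integral_nonneg (by positivity) fun _ _ => Complex.normSq_nonneg _)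

theorem normSq_exp_neg_I_mul (t : ℝ) : Complex.normSq (Complex.exp (-(Complex.I * t))) = 1 := by
  rw [Complex.normSq_eq_norm_sq, Complex.norm_exp]
  simp

theorem circleMeanSq_X_pow_mul (m : ℕ) (p : ℂ[X]) : circleMeanSq (X ^ m * p) = circleMeanSq p := by
  simp [circleMeanSq, normSq_exp_neg_I_mul]

theorem normSq_sum_le_card_mul {ι : Type*} [Fintype ι] (a : ι → ℂ) {S : Finset ι} {W : ℝ}
    (hS : ∀ i, i ∉ S → a i = 0) (hW : (S.card : ℝ) ≤ W) :
    Complex.normSq (∑ i, a i) ≤ W * ∑ i, Complex.normSq (a i) := by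
  rw [← Finset.sum_subset (Finset.subset_univ S) fun i _ hi => hS i hi]
  simp only [Complex.normSq_eq_norm_sq]
  calc ‖∑ i ∈ S, a i‖ ^ 2 ≤ (∑ i ∈ S, ‖a i‖) ^ 2 :=
        pow_le_pow_left₀ (norm_nonneg _) (norm_sum_le _ _) 2
    _ ≤ S.card * ∑ i ∈ S, ‖a i‖ ^ 2 := sq_sum_le_card_mul_sum_sq
    _ ≤ W * ∑ i, ‖a i‖ ^ 2 := by
        refine mul_le_mul hW ?_ (by positivity) ((Nat.cast_nonneg _).trans hW)
        exact Finset.sum_le_sum_of_subset_of_nonneg (Finset.subset_univ _)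
          fun _ _ _ => by positivity

/-- If at most `W` of the shifted polynomials have overlapping supports at each exponent, then the
mean square of the sum is at most `W` times the sum of the mean squares. -/
theorem circleMeanSq_sum_le {ι : Type*} [Fintype ι] (F : ι → ℂ[X]) (m : ι → ℕ) {L : ℕ} {W : ℝ}
    (hF : ∀ i, (F i).natDegree ≤ L)
    (hW : ∀ n, ((Finset.univ.filter fun i => m i ≤ n ∧ n ≤ m i + L).card : ℝ) ≤ W) :
    circleMeanSq (∑ i, X ^ m i * F i) ≤ W * ∑ i, circleMeanSq (F i) := by
  -- A common degree bound lets all the Parseval sums run over the same range, so Cauchy–Schwarz can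
  -- be applied coefficient by coefficient.
  obtain ⟨B, hB⟩ : ∃ B, ∀ i, m i ≤ B := ⟨∑ i, m i, fun i =>
    Finset.single_le_sum (f := m) (fun _ _ => Nat.zero_le _) (Finset.mem_univ i)⟩
  have hdeg (i : ι) : (X ^ m i * F i).natDegree < B + L + 1 := by
    refine Nat.lt_succ_of_le (natDegree_mul_le.trans ?_)
    rw [natDegree_X_pow]
    exact add_le_add (hB i) (hF i)
  have hdeg' : (∑ i, X ^ m i * F i).natDegree < B + L + 1 :=
    Nat.lt_succ_of_le (natDegree_sum_le_of_forall_le _ _ fun i _ => Nat.le_of_lt_succ (hdeg i))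
  have h1 (i : ι) : circleMeanSq (F i) =
      ∑ n ∈ Finset.range (B + L + 1), Complex.normSq ((X ^ m i * F i).coeff n) := by
    rw [← circleMeanSq_X_pow_mul (m i), circleMeanSq_eq_sum_coeff (hdeg i)]
  simp_rw [h1]
  rw [circleMeanSq_eq_sum_coeff hdeg', Finset.sum_comm, Finset.mul_sum]
  refine Finset.sum_le_sum fun n _ => ?_
  rw [finsetSum_coeff]
  refine normSq_sum_le_card_mul _ (fun i hi => ?_) (hW n)
  rw [coeff_X_pow_mul']
  split_ifs with h
  · refine coeff_eq_zero_of_natDegree_lt ((hF i).trans_lt ?_)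
    by_contra hc
    exact hi (by simp only [Finset.mem_filter, Finset.mem_univ, true_and]; omega)
  · rfl

end MeanSquare

/-! ### The gate fidelity in terms of Kraus operators -/

section Fidelity

variable {d M : ℕ}

theorem tensorPower_phaseGate (t : ℝ) :
    tensorPower M (phaseGate d t) =
      Matrix.diagonal fun i : Fin M → Fin d => Complex.exp (-(Complex.I * t)) ^ digitSum i := by
  ext i j
  simp only [tensorPower, phaseGate, Matrix.of_apply, Matrix.diagonal_apply]
  split_ifs with h
  · subst h
    simp only [if_true, digitSum, ← Finset.prod_pow_eq_pow_sum, ← Complex.exp_nat_mul]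
    refine Finset.prod_congr rfl fun k _ => ?_
    congr 1
    ring
  · obtain ⟨k, hk⟩ := Function.ne_iff.1 h
    exact Finset.prod_eq_zero (Finset.mem_univ k) (if_neg hk)

theorem sphere_average_ofReal {ι : Type*} [Fintype ι] (f : EuclideanSpace ℂ ι → ℝ) :
    ((⨍ x : Metric.sphere (0 : EuclideanSpace ℂ ι) 1, f x
      ∂(volume : Measure (EuclideanSpace ℂ ι)).toSphere : ℝ) : ℂ) =
      sphereAverage fun x => (f x : ℂ) :=
  integral_ofReal.symm

theorem dotProduct_conj_pureState_mulVec (B : Matrix (Fin M → Fin d) (Fin M → Fin d) ℂ)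
    (Ψ : TensorSpace d M) :
    star Ψ.ofLp ⬝ᵥ (B * pureState Ψ * Bᴴ) *ᵥ Ψ.ofLp =
      (Complex.normSq (star Ψ.ofLp ⬝ᵥ B *ᵥ Ψ.ofLp) : ℝ) := by
  rw [pureState, Matrix.mul_vecMulVec, Matrix.vecMulVec_mul, Matrix.vecMulVec_mulVec,
    ← Complex.mul_conj]
  rw [dotProduct_smul, op_smul_eq_mul, ← Matrix.star_mulVec, Matrix.star_dotProduct (B *ᵥ Ψ.ofLp)]
  rfl

theorem trace_conj_pureState (B : Matrix (Fin M → Fin d) (Fin M → Fin d) ℂ)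
    (Ψ : TensorSpace d M) :
    (B * pureState Ψ * Bᴴ).trace = (∑ i, Complex.normSq ((B *ᵥ Ψ.ofLp) i) : ℝ) := by
  rw [pureState, Matrix.mul_vecMulVec, Matrix.vecMulVec_mul, ← Matrix.star_mulVec]
  simp [Matrix.trace, Matrix.vecMulVec_apply, Complex.mul_conj]

theorem sphereAverage_normSq_mulVec {ι : Type*} [Fintype ι] [Nonempty ι] [DecidableEq ι]
    (B : Matrix ι ι ℂ) :
    sphereAverage (fun x : EuclideanSpace ℂ ι =>
        ((∑ i, Complex.normSq ((B *ᵥ x.ofLp) i) : ℝ) : ℂ)) =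
      ((∑ i, ∑ j, Complex.normSq (B i j) : ℝ) : ℂ) * (Fintype.card ι : ℂ)⁻¹ := by
  have h (x : EuclideanSpace ℂ ι) : ((∑ i, Complex.normSq ((B *ᵥ x.ofLp) i) : ℝ) : ℂ) =
      ∑ q : ι × ι × ι, (B q.1 q.2.1 * star (B q.1 q.2.2)) * (x q.2.1 * star (x q.2.2)) := by
    push_cast
    rw [Fintype.sum_prod_type]
    refine Finset.sum_congr rfl fun i _ => ?_
    rw [← Complex.mul_conj, Matrix.mulVec, dotProduct, map_sum, Finset.sum_mul_sum,
      Fintype.sum_prod_type]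
    refine Finset.sum_congr rfl fun j _ => Finset.sum_congr rfl fun k _ => ?_
    simp
    ring
  simp_rw [h]
  rw [sphereAverage_sum _ fun q _ => by fun_prop]
  simp only [sphereAverage_const_mul, sphereAverage_mul_star, Fintype.sum_prod_type]
  simp [← Complex.mul_conj, Finset.sum_mul]

variable [NeZero d] {κ : Type} [Fintype κ]

/-- The target gate is diagonal with unimodular entries, so it leaves the Hilbert–Schmidt term
unchanged and enters only through the trace. -/
theorem average_overlap_kraus (K : κ → Matrix (Fin M → Fin d) (Fin M → Fin d) ℂ) (t : ℝ) :
    (⨍ Ψ : Metric.sphere (0 : TensorSpace d M) 1,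
      (star Ψ.1.ofLp ⬝ᵥ ((tensorPower M (phaseGate d t))ᴴ *
        (∑ c, K c * pureState Ψ.1 * (K c)ᴴ) * tensorPower M (phaseGate d t)) *ᵥ Ψ.1.ofLp).re
        ∂(volume : Measure (TensorSpace d M)).toSphere) =
      (∑ c, (Complex.normSq ((tensorPower M (phaseGate d t))ᴴ * K c).trace +
        ∑ i, ∑ j, Complex.normSq (K c i j))) * ((d : ℝ) ^ M * (d ^ M + 1))⁻¹ := by
  set U := tensorPower M (phaseGate d t) with hU
  have h1 (Ψ : TensorSpace d M) : (star Ψ.ofLp ⬝ᵥ (Uᴴ *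
        (∑ c, K c * pureState Ψ * (K c)ᴴ) * U) *ᵥ Ψ.ofLp).re =
      ∑ c, Complex.normSq (star Ψ.ofLp ⬝ᵥ (Uᴴ * K c) *ᵥ Ψ.ofLp) := by
    have : Uᴴ * (∑ c, K c * pureState Ψ * (K c)ᴴ) * U =
        ∑ c, (Uᴴ * K c) * pureState Ψ * (Uᴴ * K c)ᴴ := by
      simp only [Finset.mul_sum, Finset.sum_mul, Matrix.conjTranspose_mul,
        Matrix.conjTranspose_conjTranspose, Matrix.mul_assoc]
    rw [this, Matrix.sum_mulVec, dotProduct_sum, Complex.re_sum]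
    simp only [dotProduct_conj_pureState_mulVec, Complex.ofReal_re]
  have h2 (c : κ) (i j) : Complex.normSq ((Uᴴ * K c) i j) = Complex.normSq (K c i j) := by
    rw [hU, tensorPower_phaseGate, Matrix.diagonal_conjTranspose, Matrix.diagonal_mul]
    simp [normSq_exp_neg_I_mul]
  apply Complex.ofReal_injective
  rw [sphere_average_ofReal fun Ψ : TensorSpace d M => (star Ψ.ofLp ⬝ᵥ (Uᴴ *
        (∑ c, K c * pureState Ψ * (K c)ᴴ) * U) *ᵥ Ψ.ofLp).re]
  simp only [h1, Complex.ofReal_sum]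
  rw [sphereAverage_sum]
  · simp only [sphereAverage_normSq_quadratic, h2]
    rw [← Finset.sum_mul]
    simp
  · intro c _
    have : Continuous fun Ψ : TensorSpace d M => Ψ.ofLp := PiLp.continuous_ofLp _ _
    refine Complex.continuous_ofReal.comp (Complex.continuous_normSq.comp ?_)
    exact Continuous.dotProduct (continuous_star.comp this) (continuous_const.matrix_mulVec this)

theorem average_trace_kraus (K : κ → Matrix (Fin M → Fin d) (Fin M → Fin d) ℂ) :
    (⨍ Ψ : Metric.sphere (0 : TensorSpace d M) 1, (∑ c, K c * pureState Ψ.1 * (K c)ᴴ).trace.re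
        ∂(volume : Measure (TensorSpace d M)).toSphere) =
      (∑ c, ∑ i, ∑ j, Complex.normSq (K c i j)) * ((d : ℝ) ^ M)⁻¹ := by
  apply Complex.ofReal_injective
  rw [sphere_average_ofReal fun Ψ : TensorSpace d M => (∑ c, K c * pureState Ψ * (K c)ᴴ).trace.re]
  simp only [Matrix.trace_sum, Complex.re_sum, trace_conj_pureState, Complex.ofReal_re]
  simp only [Complex.ofReal_sum (s := (Finset.univ : Finset κ))]
  rw [sphereAverage_sum]
  · simp only [sphereAverage_normSq_mulVec]
    rw [← Finset.sum_mul]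
    simp
  · intro c _
    have : Continuous fun Ψ : TensorSpace d M => Ψ.ofLp := PiLp.continuous_ofLp _ _
    refine Complex.continuous_ofReal.comp (continuous_finsetSum _ fun i _ => ?_)
    exact Complex.continuous_normSq.comp
      ((continuous_apply i).comp (continuous_const.matrix_mulVec this))

end Fidelity

/-! ### The bound on the gate fidelity -/

section Bound

open Polynomial

variable {d M N : ℕ}

theorem continuous_normSq_eval (p : ℂ[X]) :
    Continuous fun t : ℝ => Complex.normSq (p.eval (Complex.exp (-(Complex.I * t)))) :=
  Complex.continuous_normSq.comp (p.continuous.comp (by fun_prop))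

/-- Multiplying the trace by the unimodular `z ^ ((d - 1) * M)` clears the negative powers
`z^{-digitSum i}`, so polynomial Parseval applies. -/
theorem normSq_trace_gate_mul (Q : Matrix (Fin M → Fin d) (Fin M → Fin d) ℂ[X]) (t : ℝ) :
    Complex.normSq ((tensorPower M (phaseGate d t))ᴴ *
        Q.map (evalRingHom (Complex.exp (-(Complex.I * t))))).trace =
      Complex.normSq ((∑ i, X ^ ((d - 1) * M - digitSum i) * Q i i).eval
        (Complex.exp (-(Complex.I * t)))) := by
  set z := Complex.exp (-(Complex.I * t)) with hz
  have hz1 : Complex.normSq z = 1 := normSq_exp_neg_I_mul t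
  have hz2 : z * star z = 1 := by
    rw [Complex.star_def, Complex.mul_conj, hz1, Complex.ofReal_one]
  have hle (i : Fin M → Fin d) : digitSum i ≤ (d - 1) * M := by
    have : digitSum i ≤ ∑ _k : Fin M, (d - 1) := Finset.sum_le_sum fun k _ => by omega
    simpa [mul_comm] using this
  have h : (∑ i, X ^ ((d - 1) * M - digitSum i) * Q i i).eval z =
      z ^ ((d - 1) * M) * ((tensorPower M (phaseGate d t))ᴴ * Q.map (evalRingHom z)).trace := by
    rw [tensorPower_phaseGate, Matrix.diagonal_conjTranspose, Matrix.trace, Finset.mul_sum,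
      eval_finsetSum]
    refine Finset.sum_congr rfl fun i _ => ?_
    rw [Matrix.diag_apply, Matrix.diagonal_mul, ← hz]
    simp only [Pi.star_apply, star_pow, Matrix.map_apply, coe_evalRingHom, eval_mul, eval_pow,
      eval_X]
    nth_rewrite 2 [← Nat.sub_add_cancel (hle i)]
    have : z ^ digitSum i * star z ^ digitSum i = 1 := by rw [← mul_pow, hz2, one_pow]
    rw [pow_add]
    linear_combination (-(z ^ ((d - 1) * M - digitSum i)) * (Q i i).eval z) * this
  rw [h, map_mul, map_pow, hz1, one_pow, one_mul]

theorem GateNetwork.averageOverlap_nonneg_and_le (hd : 2 ≤ d) (hM : 0 < M)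
    (G : GateNetwork d M N) :
    0 ≤ G.averageOverlap ∧ 0 ≤ G.successProbability ∧ G.averageOverlap ≤
      ((((d - 1) * N : ℕ) + 1) * Real.sqrt (d * Real.pi / 4 / M) + ((d : ℝ) ^ M)⁻¹) *
        G.successProbability := by
  have : NeZero d := ⟨by omega⟩
  obtain ⟨κ, _, Q, hQ, hG⟩ := G.exists_polynomial_kraus
  set S : ℝ := ∑ c, ∑ i, ∑ j, circleMeanSq (Q c i j) with hS
  set T : ℝ := ∑ c, circleMeanSq (∑ i, X ^ ((d - 1) * M - digitSum i) * Q c i i) with hT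
  have hD : (0 : ℝ) < (d : ℝ) ^ M := by positivity
  have hS0 : 0 ≤ S := Finset.sum_nonneg fun c _ => Finset.sum_nonneg fun i _ =>
    Finset.sum_nonneg fun j _ => circleMeanSq_nonneg _
  have hT0 : 0 ≤ T := Finset.sum_nonneg fun c _ => circleMeanSq_nonneg _
  have hint (p : ℂ[X]) : IntervalIntegrable (fun t : ℝ =>
      Complex.normSq (p.eval (Complex.exp (-(Complex.I * t))))) volume 0 (2 * Real.pi) :=
    (continuous_normSq_eval p).intervalIntegrable _ _
  have hSint : (2 * Real.pi)⁻¹ * ∫ t in (0 : ℝ)..(2 * Real.pi), (∑ c, ∑ i, ∑ j,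
      Complex.normSq ((Q c i j).eval (Complex.exp (-(Complex.I * t))))) = S := by
    have : ∀ c i j, Continuous fun t : ℝ =>
        Complex.normSq ((Q c i j).eval (Complex.exp (-(Complex.I * t)))) :=
      fun c i j => continuous_normSq_eval _
    rw [intervalIntegral.integral_finsetSum fun c _ =>
      (by fun_prop : Continuous _).intervalIntegrable _ _, Finset.mul_sum]
    refine Finset.sum_congr rfl fun c _ => ?_
    rw [intervalIntegral.integral_finsetSum fun i _ =>
      (by fun_prop : Continuous _).intervalIntegrable _ _, Finset.mul_sum]
    refine Finset.sum_congr rfl fun i _ => ?_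
    rw [intervalIntegral.integral_finsetSum fun j _ => hint _, Finset.mul_sum]
    rfl
  have hp : G.successProbability = S * ((d : ℝ) ^ M)⁻¹ := by
    rw [← hSint, GateNetwork.successProbability, phaseStateAverage]
    simp only [hG, average_trace_kraus]
    rw [intervalIntegral.integral_mul_const, mul_assoc]
    rfl
  have ha : G.averageOverlap = (T + S) * ((d : ℝ) ^ M * (d ^ M + 1))⁻¹ := by
    rw [← hSint, GateNetwork.averageOverlap, phaseStateAverage]
    simp only [hG, average_overlap_kraus, normSq_trace_gate_mul]
    rw [intervalIntegral.integral_mul_const, ← mul_assoc]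
    congr 1
    have h1 : ∀ c, Continuous fun t : ℝ => Complex.normSq
        ((∑ i, X ^ ((d - 1) * M - digitSum i) * Q c i i).eval (Complex.exp (-(Complex.I * t)))) :=
      fun c => continuous_normSq_eval _
    have h2 : ∀ c i j, Continuous fun t : ℝ =>
        Complex.normSq ((Q c i j).eval (Complex.exp (-(Complex.I * t)))) :=
      fun c i j => continuous_normSq_eval _
    simp only [Finset.sum_add_distrib]
    simp only [Matrix.map_apply, coe_evalRingHom]
    rw [intervalIntegral.integral_add
      ((continuous_finsetSum _ fun c _ => h1 c).intervalIntegrable _ _)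
      ((by fun_prop : Continuous _).intervalIntegrable _ _), mul_add]
    congr 1
    rw [intervalIntegral.integral_finsetSum fun c _ => hint _, Finset.mul_sum]
    rfl
  set w : ℝ := (((d - 1) * N : ℕ) + 1) * Real.sqrt (d * Real.pi / 4 / M) with hw
  have hTS : T ≤ (w * d ^ M) * S := by
    rw [hT, hS, Finset.mul_sum]
    refine Finset.sum_le_sum fun c _ => ?_
    have hW (n : ℕ) : ((Finset.univ.filter fun i : Fin M → Fin d =>
        (d - 1) * M - digitSum i ≤ n ∧
          n ≤ (d - 1) * M - digitSum i + (d - 1) * N).card : ℝ) ≤ w * d ^ M := by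
      refine le_trans ?_ ((card_digitSum_window_le hd hM ((d - 1) * N) ((d - 1) * M) n).trans
        (le_of_eq ?_))
      · refine Nat.cast_le.2 (Finset.card_le_card fun i hi => ?_)
        have hle : digitSum i ≤ (d - 1) * M := by
          have : digitSum i ≤ ∑ _k : Fin M, (d - 1) := Finset.sum_le_sum fun k _ => by omega
          simpa [mul_comm] using this
        simp only [Finset.mem_filter, Finset.mem_univ, true_and] at hi ⊢
        omega
      · rw [hw]
        ring
    refine (circleMeanSq_sum_le (fun i => Q c i i) _ (fun i => hQ c i i) hW).trans ?_
    refine mul_le_mul_of_nonneg_left (Finset.sum_le_sum fun i _ => ?_) (by positivity)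
    -- The trace sees only diagonal entries; the off-diagonal ones in `S` are nonnegative.
    exact Finset.single_le_sum (f := fun j => circleMeanSq (Q c i j))
      (fun j _ => circleMeanSq_nonneg _) (Finset.mem_univ i)
  refine ⟨by rw [ha]; positivity, by rw [hp]; positivity, ?_⟩
  rw [ha, hp]
  have hw0 : 0 ≤ w := by positivity
  -- Weakening `D + 1` to `D` leaves `(w + 1 / D) * (S / D)`.
  calc (T + S) * ((d : ℝ) ^ M * (d ^ M + 1))⁻¹ ≤
      ((w * d ^ M) * S + S) * ((d : ℝ) ^ M * d ^ M)⁻¹ := by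
        gcongr
        linarith
    _ = _ := by
        field_simp

theorem OpenNetwork.IsDeterministic.trace_insert {inp : Type} [Fintype inp] [DecidableEq inp]
    {a : ℕ} {P : OpenNetwork d inp N a} (h : P.IsDeterministic)
    (t : ℝ) (Y : Matrix inp inp ℂ) : (P.insert (phaseGate d t) Y).trace = Y.trace := by
  induction P with
  | start E => exact h Y
  | @step N a b P E ih =>
    simp only [OpenNetwork.insert, LinearMap.comp_apply]
    rw [h.2, applyGate, LinearMap.coe_mk, AddHom.coe_mk, Matrix.trace_mul_comm, ← Matrix.mul_assoc]
    have hU : (phaseGate d t ⊗ₖ (1 : Matrix (Fin a) (Fin a) ℂ))ᴴ *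
        (phaseGate d t ⊗ₖ (1 : Matrix (Fin a) (Fin a) ℂ)) = 1 := by
      rw [phaseGate, ← Matrix.diagonal_one, Matrix.diagonal_kronecker_diagonal,
        Matrix.diagonal_conjTranspose, Matrix.diagonal_mul_diagonal, ← Matrix.diagonal_one]
      congr 1
      ext q
      simp only [Pi.star_apply, mul_one, Complex.star_def]
      rw [← Complex.normSq_eq_conj_mul_self, Complex.normSq_eq_norm_sq, Complex.norm_exp]
      simp
    rw [hU, one_mul]
    exact ih h.1

theorem GateNetwork.IsDeterministic.successProbability_eq_one [NeZero d] {G : GateNetwork d M N}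
    (h : G.IsDeterministic) : G.successProbability = 1 := by
  have h1 (t : ℝ) (Ψ : Metric.sphere (0 : TensorSpace d M) 1) :
      (G.insert (phaseGate d t) (pureState Ψ.1)).trace.re = 1 := by
    rw [GateNetwork.insert, LinearMap.comp_apply, h.2, h.1.trace_insert]
    have := trace_conj_pureState 1 Ψ.1
    rw [Matrix.conjTranspose_one, mul_one, one_mul] at this
    rw [this, Complex.ofReal_re]
    simp only [Matrix.one_mulVec, Complex.normSq_eq_norm_sq]
    rw [← EuclideanSpace.norm_sq_eq]
    simp
  have : NeZero (volume : Measure (TensorSpace d M)).toSphere := ⟨Measure.toSphere_ne_zero _⟩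
  simp only [GateNetwork.successProbability, phaseStateAverage, h1, average_const]
  simp
  field_simp

end Bound

/-! ### The asymptotics of the bound -/

theorem eventually_rpow_lt_of_lt_replicationRate {M : ℕ → ℕ} (hM : 2 < replicationRate M) :
    ∃ r : ℝ, 2 < r ∧ ∀ᶠ N : ℕ in atTop, (N : ℝ) ^ r ≤ M N ∧ N < M N := by
  obtain ⟨r, hr1, hr2⟩ := EReal.exists_between_coe_real hM
  refine ⟨r, EReal.coe_lt_coe_iff.1 hr1, ?_⟩
  -- `N ≥ 2` makes `log N` positive, so the quotient can be cleared.
  filter_upwards [eventually_lt_of_lt_liminf hr2, eventually_ge_atTop 2] with N hN hN2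
  split_ifs at hN with h
  · refine ⟨?_, h⟩
    have hN' : r < Real.log ((M N : ℝ) - N) / Real.log N := by exact_mod_cast hN
    have hN1 : (1 : ℝ) < N := by exact_mod_cast hN2
    have hpos : 0 < (M N : ℝ) - N := sub_pos.2 (by exact_mod_cast h)
    rw [lt_div_iff₀ (Real.log_pos hN1)] at hN'
    have := (Real.rpow_lt_iff_lt_log (by linarith) hpos).2 hN'
    linarith [(Nat.cast_nonneg N : (0 : ℝ) ≤ N)]
  · simp at hN

/-- The first term is at most a constant times `N * N ^ (-r / 2)`. This is where the threshold `2`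
arises: the spread `√M` must outgrow the degree, of order `N`. -/
theorem tendsto_fidelity_bound {d : ℕ} (hd : 2 ≤ d) {M : ℕ → ℕ} (hM : 2 < replicationRate M) :
    Tendsto (fun N : ℕ => (((d - 1) * N : ℕ) + 1) * Real.sqrt (d * Real.pi / 4 / M N) +
      ((d : ℝ) ^ M N)⁻¹) atTop (𝓝 0) := by
  obtain ⟨r, hr, h⟩ := eventually_rpow_lt_of_lt_replicationRate hM
  have hMt : Tendsto M atTop atTop :=
    tendsto_atTop_mono' _ (h.mono fun N hN => hN.2.le) tendsto_id
  have h2 : Tendsto (fun N : ℕ => ((d : ℝ) ^ M N)⁻¹) atTop (𝓝 0) :=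
    tendsto_inv_atTop_zero.comp ((tendsto_pow_atTop_atTop_of_one_lt
      (by exact_mod_cast (by omega : 1 < d))).comp hMt)
  have h3 : Tendsto (fun N : ℕ => d * Real.sqrt (d * Real.pi / 4) * (N : ℝ) ^ (-(r / 2 - 1)))
      atTop (𝓝 0) := by
    have := (tendsto_rpow_neg_atTop (y := r / 2 - 1) (by linarith)).comp
      (tendsto_natCast_atTop_atTop (R := ℝ))
    simpa using this.const_mul (d * Real.sqrt (d * Real.pi / 4))
  have h4 : Tendsto (fun N : ℕ => (((d - 1) * N : ℕ) + 1) * Real.sqrt (d * Real.pi / 4 / M N))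
      atTop (𝓝 0) := by
    refine squeeze_zero' (Eventually.of_forall fun N => by positivity) ?_ h3
    filter_upwards [h, eventually_ge_atTop 1] with N hN hN1
    have hN0 : (0 : ℝ) < N := by exact_mod_cast hN1
    have e1 : ((((d - 1) * N : ℕ) : ℝ) + 1) ≤ d * N := by
      have : (d - 1) * N + 1 ≤ d * N := by
        obtain ⟨e, rfl⟩ := Nat.exists_eq_add_of_le hd
        have : 2 + e - 1 = 1 + e := by omega
        rw [this]
        nlinarith
      exact_mod_cast this
    have e2 : Real.sqrt (d * Real.pi / 4 / M N) ≤
        Real.sqrt (d * Real.pi / 4) * (N : ℝ) ^ (-(r / 2)) := by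
      rw [Real.sqrt_div (by positivity), div_eq_mul_inv]
      refine mul_le_mul_of_nonneg_left ?_ (Real.sqrt_nonneg _)
      rw [Real.rpow_neg hN0.le]
      refine inv_anti₀ (by positivity) ?_
      refine Real.le_sqrt_of_sq_le ?_
      rw [← Real.rpow_natCast, ← Real.rpow_mul hN0.le]
      simpa using hN.1
    calc _ ≤ (d * N : ℝ) * (Real.sqrt (d * Real.pi / 4) * (N : ℝ) ^ (-(r / 2))) := by
          gcongr
      _ = _ := by
          rw [neg_sub, sub_eq_add_neg, Real.rpow_add hN0, Real.rpow_one]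
          ring
  simpa using h4.add h2

theorem mainTheorem4 (d : ℕ) (hd : 2 ≤ d) (M : ℕ → ℕ) (hM : 2 < replicationRate M)
    (C : ∀ N : ℕ, GateNetwork d (M N) N) :
    ((∀ᶠ N in atTop, 0 < (C N).successProbability) →
      Tendsto (fun N => (C N).gateFidelity) atTop (𝓝 0)) ∧
    ((∀ N, (C N).IsDeterministic) →
      Tendsto (fun N => (C N).averageOverlap) atTop (𝓝 0)) := by
  have hb := tendsto_fidelity_bound hd hM
  obtain ⟨r, -, hr⟩ := eventually_rpow_lt_of_lt_replicationRate hM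
  -- At `M N = 0` the square root in the bound would be `√(x / 0) = 0` and the counting estimate
  -- would fail.
  have hpos : ∀ᶠ N in atTop, 0 < M N := hr.mono fun N hN => (Nat.zero_le N).trans_lt hN.2
  constructor
  · intro hp
    refine squeeze_zero' ?_ ?_ hb
    · filter_upwards [hpos] with N hN
      obtain ⟨h1, h2, -⟩ := (C N).averageOverlap_nonneg_and_le hd hN
      exact div_nonneg h1 h2
    · filter_upwards [hpos, hp] with N hN hpN
      exact (div_le_iff₀ hpN).2 ((C N).averageOverlap_nonneg_and_le hd hN).2.2
  · intro hdet
    have : NeZero d := ⟨by omega⟩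
    refine squeeze_zero' ?_ ?_ hb
    · filter_upwards [hpos] with N hN
      exact ((C N).averageOverlap_nonneg_and_le hd hN).1
    · filter_upwards [hpos] with N hN
      have h := ((C N).averageOverlap_nonneg_and_le hd hN).2.2
      rwa [(hdet N).successProbability_eq_one, mul_one] at h
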